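/- **Theorem (Identifiability under changing causal dynamics).** Let $(\mathbf z_t)$ be a latent process in $\mathbb R^n$, observed as $\mathbf x_t=\mathbf g(\mathbf z_t)$ with $\mathbf g$ invertible (onto the set of its values), in $m$ contexts $u_1,\dots,u_m$; the law of the process may change with the context, while $\mathbf g$ does not. Let $\hat{\mathbf g}$ be an invertible function on the values of $\mathbf x_t$ and put $\hat{\mathbf z}_t=\hat{\mathbf g}(\mathbf x_t)\in\mathbb R^n$. Suppose that the map $\hat{\mathbf g}\circ\mathbf g:\mathbb R^n\to\mathbb R^n$ is twice continuously differentiable with everywhere invertible Jacobian. Fix a time $t$. Suppose that in each context $u_r$ the vector $\mathbf z_{t-1}$ has full support in $\mathbb R^n$, the components $z_{1t},\dots,z_{nt}$ of $\mathbf z_t$ are mutually independent conditional on $\mathbf z_{t-1}$, and $z_{kt}$ has an everywhere positive conditional density $p(z_{kt}\mid\mathbf z_{t-1};u_r)$. Put $\eta_{kt}(u_r)=\log p(z_{kt}\mid\mathbf z_{t-1};u_r)$ and assume that $\eta_{kt}(u_r)$ is twice differentiable in $z_{kt}$ and that $\eta_{kt}(u_r)$, $\partial\eta_{kt}(u_r)/\partial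 z_{kt}$ and $\partial^2\eta_{kt}(u_r)/\partial z_{kt}^2$ are differentiable in $\mathbf z_{t-1}$. Suppose also that in each context the components of $\hat{\mathbf z}_t$ are mutually independent conditional on $\hat{\mathbf z}_{t-1}$. Define $$\mathbf v_{kt}(u_r)=\Big(\tfrac{\partial}{\partial z_{l,t-1}}\tfrac{\partial\eta_{kt}(u_r)}{\partial z_{kt}}\Big)_{l=1}^n,\qquad \mathring{\mathbf v}_{kt}(u_r)=\Big(\tfrac{\partial}{\partial z_{l,t-1}}\tfrac{\partial^2\eta_{kt}(u_r)}{\partial z_{kt}^2}\Big)_{l=1}^n,$$ $$\mathbf s_{kt}=\Big(\mathbf v_{kt}(u_1)^\top,\dots,\mathbf v_{kt}(u_m)^\top,\ \tfrac{\partial\eta_{kt}(u_2)}{\partial z_{kt}}-\tfrac{\partial\eta_{kt}(u_1)}{\partial z_{kt}},\dots,\tfrac{\partial\eta_{kt}(u_m)}{\partial z_{kt}}-\tfrac{\partial\eta_{kt}(u_{m-1})}{\partial z_{kt}}\Big)^\top,$$ $$\mathring{\mathbf s}_{kt}=\Big(\mathring{\mathbf v}_{kt}(u_1)^\top,\dots,\mathring{\mathbf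 v}_{kt}(u_m)^\top,\ \tfrac{\partial^2\eta_{kt}(u_2)}{\partial z_{kt}^2}-\tfrac{\partial^2\eta_{kt}(u_1)}{\partial z_{kt}^2},\dots,\tfrac{\partial^2\eta_{kt}(u_m)}{\partial z_{kt}^2}-\tfrac{\partial^2\eta_{kt}(u_{m-1})}{\partial z_{kt}^2}\Big)^\top.$$ If for each value of $\mathbf z_t$ the $2n$ vector functions $\mathbf s_{1t},\dots,\mathbf s_{nt},\mathring{\mathbf s}_{1t},\dots,\mathring{\mathbf s}_{nt}$ of $\mathbf z_{t-1}\in\mathbb R^n$ are linearly independent over $\mathbb R$, then $\hat{\mathbf z}_t$ is a permuted, invertible, component-wise transformation of $\mathbf z_t$: there are a permutation $\sigma$ of $\{1,\dots,n\}$ and functions $T_1,\dots,T_n:\mathbb R\to\mathbb R$, each a homeomorphism onto an open interval, such that $\hat{\mathbf g}(\mathbf g(\mathbf z))_i=T_i(z_{\sigma(i)})$ for all $\mathbf z\in\mathbb R^n$ and all $i$; in particular $\hat z_{it}=T_i(z_{\sigma(i),t})$ for all $i$ (and the same holds at every other time). -/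

import Mathlib

open MeasureTheory ProbabilityTheory

noncomputable section

/-- `p` is a conditional density, with respect to Lebesgue measure, of the real random variable `W`
given `Y`: for almost every value `y` of `Y`, the conditional distribution of `W` given `Y = y` has
density `a ↦ p a y`. -/
def IsCondDensity {Ω : Type*} [MeasurableSpace Ω] {n : ℕ} (P : Measure Ω) [IsFiniteMeasure P]
    (W : Ω → ℝ) (Y : Ω → Fin n → ℝ) (p : ℝ → (Fin n → ℝ) → ℝ) : Prop :=
  ∀ᵐ y ∂(P.map Y),
    condDistrib W Y P y = (volume : Measure ℝ).withDensity fun a => ENNReal.ofReal (p a y)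

/-- The components of the random vector `W` are mutually independent conditional on `Y`
(that is, on the sigma-algebra generated by `Y`). -/
def CondIndepComponents {Ω : Type*} [MeasurableSpace Ω] [StandardBorelSpace Ω] {n : ℕ}
    (P : Measure Ω) [IsFiniteMeasure P] (W Y : Ω → Fin n → ℝ) (hY : Measurable Y) : Prop :=
  iCondIndepFun (MeasurableSpace.comap Y inferInstance) hY.comap_le (fun i ω => W ω i) P

/-- The log-densities `η_k(u_r) = log p(z_k | y; u_r)`, as functions of `a = z_k` (the current value
of the component `k`) and `y` (the previous value of the whole vector). -/
def logDensity {m n : ℕ} (p : Fin m → Fin n → ℝ → (Fin n → ℝ) → ℝ) :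
    Fin m → Fin n → ℝ → (Fin n → ℝ) → ℝ :=
  fun r k a y => Real.log (p r k a y)

/-- `∂ η_k(u_r) / ∂ z_k`. -/
def dEta {m n : ℕ} (η : Fin m → Fin n → ℝ → (Fin n → ℝ) → ℝ) (r : Fin m) (k : Fin n)
    (a : ℝ) (y : Fin n → ℝ) : ℝ :=
  deriv (fun b => η r k b y) a

/-- `∂² η_k(u_r) / ∂ z_k²`. -/
def d2Eta {m n : ℕ} (η : Fin m → Fin n → ℝ → (Fin n → ℝ) → ℝ) (r : Fin m) (k : Fin n)
    (a : ℝ) (y : Fin n → ℝ) : ℝ :=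
  deriv (fun b => dEta η r k b y) a

/-- The entry `l` of `v_k(u_r)`: the partial derivative of `∂ η_k(u_r) / ∂ z_k` with respect to the
coordinate `l` of the previous value `y`. -/
def vEntry {m n : ℕ} (η : Fin m → Fin n → ℝ → (Fin n → ℝ) → ℝ) (r : Fin m) (k l : Fin n)
    (a : ℝ) (y : Fin n → ℝ) : ℝ :=
  fderiv ℝ (fun y' => dEta η r k a y') y (Pi.single l 1)

/-- The entry `l` of `v̊_k(u_r)`: the partial derivative of `∂² η_k(u_r) / ∂ z_k²` with respect to
the coordinate `l` of the previous value `y`. -/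
def vRingEntry {m n : ℕ} (η : Fin m → Fin n → ℝ → (Fin n → ℝ) → ℝ) (r : Fin m) (k l : Fin n)
    (a : ℝ) (y : Fin n → ℝ) : ℝ :=
  fderiv ℝ (fun y' => d2Eta η r k a y') y (Pi.single l 1)

/-- The first context `u_i` of the pair `(u_i, u_{i+1})`, for `i` among the `m - 1` consecutive
pairs of contexts. -/
def ctxCur {m : ℕ} (i : Fin (m - 1)) : Fin m := ⟨i.1, by omega⟩

/-- The second context `u_{i+1}` of the pair `(u_i, u_{i+1})`. -/
def ctxNext {m : ℕ} (i : Fin (m - 1)) : Fin m := ⟨i.1 + 1, by omega⟩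

/-- The stacked vector `s_k`: the vectors `v_k(u_1), …, v_k(u_m)`, followed by the `m - 1`
differences of `∂ η_k / ∂ z_k` between consecutive contexts. -/
def sVec {m n : ℕ} (η : Fin m → Fin n → ℝ → (Fin n → ℝ) → ℝ) (k : Fin n)
    (a : ℝ) (y : Fin n → ℝ) : (Fin m × Fin n) ⊕ Fin (m - 1) → ℝ :=
  Sum.elim (fun q => vEntry η q.1 k q.2 a y)
    (fun i => dEta η (ctxNext i) k a y - dEta η (ctxCur i) k a y)

/-- The stacked vector `s̊_k`: the vectors `v̊_k(u_1), …, v̊_k(u_m)`, followed by the `m - 1`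
differences of `∂² η_k / ∂ z_k²` between consecutive contexts. -/
def sRingVec {m n : ℕ} (η : Fin m → Fin n → ℝ → (Fin n → ℝ) → ℝ) (k : Fin n)
    (a : ℝ) (y : Fin n → ℝ) : (Fin m × Fin n) ⊕ Fin (m - 1) → ℝ :=
  Sum.elim (fun q => vRingEntry η q.1 k q.2 a y)
    (fun i => d2Eta η (ctxNext i) k a y - d2Eta η (ctxCur i) k a y)

/-- The `2n` vector functions `s_1, …, s_n, s̊_1, …, s̊_n` of the previous value `y`, at a fixed
current value `z`. -/
def sFamily {m n : ℕ} (η : Fin m → Fin n → ℝ → (Fin n → ℝ) → ℝ) (z : Fin n → ℝ) :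
    Fin n ⊕ Fin n → (Fin n → ℝ) → (Fin m × Fin n) ⊕ Fin (m - 1) → ℝ :=
  Sum.elim (fun k y => sVec η k (z k) y) (fun k y => sRingVec η k (z k) y)

/-- The regularity of the log-densities: each `η_k(u_r)` is twice differentiable in `z_k`, and it
and its first two derivatives in `z_k` are differentiable in the previous value `y`. -/
structure RegularLogDensity {m n : ℕ} (η : Fin m → Fin n → ℝ → (Fin n → ℝ) → ℝ) : Prop where
  diff_z : ∀ r k y, Differentiable ℝ fun a => η r k a y
  diff_dz : ∀ r k y, Differentiable ℝ fun a => dEta η r k a y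
  diff_y : ∀ r k a, Differentiable ℝ fun y => η r k a y
  diff_y_dz : ∀ r k a, Differentiable ℝ fun y => dEta η r k a y
  diff_y_d2z : ∀ r k a, Differentiable ℝ fun y => d2Eta η r k a y

end

open Filter Topology

/-! Put `h = ghat ∘ g`. For almost every previous value `y`, in each context, `h` carries a product
law with density `q` to a product law. The image density would be `q` over the Jacobian determinant,
but `h` is only `C²`, so the log-determinant need not have second derivatives. It is therefore
cancelled rather than differentiated: comparing two pairs (context, previous value) on the
`h`-preimages of small cubes, `density_cross_ratio` shows that the mixed differences of `log q` over
the preimage of a coordinate rectangle are the same for both pairs. Full support and continuity in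
`y` extend this from almost every `y` to all `y`. Differentiating along the local inverse `f` of `h`
(`mixed_deriv_eq_zero`) gives, for `i ≠ j`, a linear relation between differences of the first and
second derivatives of the log-densities. The coefficients of the second derivatives are the products
`∂ᵢfₖ · ∂ⱼfₖ`, and linear independence makes them vanish (`coeff_eq_zero`). So each row of the
Jacobian of `f`, hence of `h`, has a single non-zero entry; by connectedness its position does not
depend on the point, and `exists_perm_componentwise` integrates this. -/

/-! ### Product densities and their cross-ratios -/

/-- The product of finitely many measures with integrable densities has the product density. -/
theorem pi_withDensity_ofReal {ι : Type*} [Fintype ι] (f : ι → ℝ → ℝ)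
    (hf : ∀ i, Integrable (f i)) (hf0 : ∀ i a, 0 ≤ f i a) :
    Measure.pi (fun i => (volume : Measure ℝ).withDensity fun a => ENNReal.ofReal (f i a)) =
      (volume : Measure (ι → ℝ)).withDensity fun x => ENNReal.ofReal (∏ i, f i (x i)) := by
  have hsf : ∀ i, SigmaFinite ((volume : Measure ℝ).withDensity fun a => ENNReal.ofReal (f i a)) :=
    fun i => SigmaFinite.withDensity_ofReal _
  refine Measure.pi_eq fun s hs => ?_
  have hbox : MeasurableSet (Set.univ.pi s) := MeasurableSet.univ_pi hs
  have hint : Integrable fun x : ι → ℝ => ∏ i, f i (x i) := Integrable.fintype_prod hf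
  rw [withDensity_apply _ hbox, ← ofReal_integral_eq_lintegral_ofReal hint.integrableOn
    (ae_of_all _ fun x => Finset.prod_nonneg fun i _ => hf0 i _)]
  have hi : ∀ i, (volume : Measure ℝ).withDensity (fun a => ENNReal.ofReal (f i a)) (s i) =
      ENNReal.ofReal (∫ a in s i, f i a) := fun i => by
    rw [withDensity_apply _ (hs i), ← ofReal_integral_eq_lintegral_ofReal (hf i).integrableOn
      (ae_of_all _ (hf0 i))]
  simp_rw [hi]
  rw [← ENNReal.ofReal_prod_of_nonneg fun i _ => integral_nonneg (hf0 i)]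
  congr 1
  rw [volume_pi, Measure.restrict_pi_pi]
  exact integral_fintype_prod_eq_prod f

/-- The mean density over small sets shrinking to a point tends to the density at the point. -/
theorem tendsto_withDensity_div_volume {ι : Type*} [Fintype ι] {q : (ι → ℝ) → ℝ}
    (hq : Continuous q) (hq0 : ∀ z, 0 ≤ q z) {A : ℝ → Set (ι → ℝ)} {a : ι → ℝ}
    (hAo : ∀ ε, IsOpen (A ε)) (hA : Tendsto A (𝓝[>] 0) (𝓝 a).smallSets)
    (hpos : ∀ᶠ ε in 𝓝[>] 0, (volume : Measure (ι → ℝ)).real (A ε) ≠ 0) :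
    Tendsto (fun ε =>
      ((volume : Measure (ι → ℝ)).withDensity fun z => ENNReal.ofReal (q z)).real (A ε) /
        (volume : Measure (ι → ℝ)).real (A ε)) (𝓝[>] 0) (𝓝 (q a)) := by
  have ho := hq.continuousAt.integral_sub_linear_isLittleO_ae (x := a) (μ := volume)
    (hq.stronglyMeasurable.stronglyMeasurableAtFilter) hA
  have hlim := ho.tendsto_div_nhds_zero.add_const (q a)
  rw [zero_add] at hlim
  refine hlim.congr' ?_
  filter_upwards [hpos] with ε hε
  have : ((volume : Measure (ι → ℝ)).withDensity fun z => ENNReal.ofReal (q z)).real (A ε) =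
      ∫ z in A ε, q z := by
    rw [measureReal_def, withDensity_apply _ (hAo ε).measurableSet,
      integral_eq_lintegral_of_nonneg_ae (ae_of_all _ hq0) hq.aestronglyMeasurable]
  rw [this, smul_eq_mul]
  field_simp
  ring

/-- If two measures with positive continuous densities are both mapped to product measures by the
same open embedding, then the quotient of the densities is multiplicative along the images of the
coordinate rectangles. -/
theorem density_cross_ratio {ι : Type*} [Fintype ι] {h : (ι → ℝ) → ι → ℝ}
    (hh : IsOpenEmbedding h) {q q' : (ι → ℝ) → ℝ} (hq : Continuous q) (hq' : Continuous q')
    (hq0 : ∀ z, 0 < q z) (hq0' : ∀ z, 0 < q' z) {ν ν' : ι → Measure ℝ}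
    [∀ i, IsProbabilityMeasure (ν i)] [∀ i, IsProbabilityMeasure (ν' i)]
    (hν : ((volume : Measure (ι → ℝ)).withDensity fun z => ENNReal.ofReal (q z)).map h =
      Measure.pi ν)
    (hν' : ((volume : Measure (ι → ℝ)).withDensity fun z => ENNReal.ofReal (q' z)).map h =
      Measure.pi ν')
    {a b c d : ι → ℝ}
    (hrect : ∀ i, (h a i = h b i ∧ h d i = h c i) ∨ (h a i = h c i ∧ h d i = h b i)) :
    q a * q d * (q' b * q' c) = q b * q c * (q' a * q' d) := by
  -- Sup-norm balls are boxes, so the pushed-forward product measure factorizes on them.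
  set A : (ι → ℝ) → ℝ → Set (ι → ℝ) := fun x ε => h ⁻¹' Metric.ball (h x) ε
  have hAo : ∀ x ε, IsOpen (A x ε) := fun x ε => Metric.isOpen_ball.preimage hh.continuous
  have hA : ∀ x, Tendsto (A x) (𝓝[>] 0) (𝓝 x).smallSets := by
    intro x
    rw [tendsto_smallSets_iff]
    intro U hU
    rw [hh.isInducing.nhds_eq_comap] at hU
    obtain ⟨V, hV, hVU⟩ := hU
    obtain ⟨δ, hδ, hδV⟩ := Metric.mem_nhds_iff.1 hV
    filter_upwards [Ioo_mem_nhdsGT hδ] with ε hε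
    exact (Set.preimage_mono ((Metric.ball_subset_ball hε.2.le).trans hδV)).trans hVU
  have hvol : ∀ x, ∀ᶠ ε in 𝓝[>] 0, (volume : Measure (ι → ℝ)).real (A x ε) ≠ 0 := by
    intro x
    have h1 := tendsto_smallSets_iff.1 (hA x) _ (Metric.closedBall_mem_nhds x one_pos)
    filter_upwards [h1, self_mem_nhdsWithin] with ε h1 hε
    rw [measureReal_def, ENNReal.toReal_ne_zero]
    exact ⟨((hAo x ε).measure_pos _ ⟨x, Metric.mem_ball_self hε⟩).ne',
      measure_ne_top_of_subset h1 (isCompact_closedBall x 1).measure_ne_top⟩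
  have hmass : ∀ (κ : ι → Measure ℝ) [∀ i, IsProbabilityMeasure (κ i)] (f : (ι → ℝ) → ℝ),
      ((volume : Measure (ι → ℝ)).withDensity fun z => ENNReal.ofReal (f z)).map h =
        Measure.pi κ → ∀ ε > 0, ∀ x,
      ((volume : Measure (ι → ℝ)).withDensity fun z => ENNReal.ofReal (f z)).real (A x ε) =
        ∏ i, (κ i).real (Metric.ball (h x i) ε) := by
    intro κ _ f hf ε hε x
    rw [measureReal_def, ← Measure.map_apply hh.continuous.measurable measurableSet_ball, hf,
      ball_pi _ hε, Measure.pi_pi, ENNReal.toReal_prod]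
    rfl
  have hswap : ∀ (κ : ι → Measure ℝ) [∀ i, IsProbabilityMeasure (κ i)] (f : (ι → ℝ) → ℝ),
      ((volume : Measure (ι → ℝ)).withDensity fun z => ENNReal.ofReal (f z)).map h =
        Measure.pi κ → ∀ ε > 0,
      ((volume : Measure (ι → ℝ)).withDensity fun z => ENNReal.ofReal (f z)).real (A a ε) *
      ((volume : Measure (ι → ℝ)).withDensity fun z => ENNReal.ofReal (f z)).real (A d ε) =
      ((volume : Measure (ι → ℝ)).withDensity fun z => ENNReal.ofReal (f z)).real (A b ε) *
      ((volume : Measure (ι → ℝ)).withDensity fun z => ENNReal.ofReal (f z)).real (A c ε) := by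
    intro κ _ f hf ε hε
    simp only [hmass κ f hf ε hε, ← Finset.prod_mul_distrib]
    refine Finset.prod_congr rfl fun i _ => ?_
    rcases hrect i with ⟨h1, h2⟩ | ⟨h1, h2⟩ <;> rw [h1, h2]
    rw [mul_comm]
  have L := fun x => tendsto_withDensity_div_volume hq (fun z => (hq0 z).le) (hAo x) (hA x) (hvol x)
  have L' := fun x =>
    tendsto_withDensity_div_volume hq' (fun z => (hq0' z).le) (hAo x) (hA x) (hvol x)
  -- The unknown volumes of the four sets occur once each in the denominators on both sides, so they
  -- cancel; this replaces the Jacobian factor.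
  refine tendsto_nhds_unique (((L a).mul (L d)).mul ((L' b).mul (L' c)))
    ((((L b).mul (L c)).mul ((L' a).mul (L' d))).congr' ?_)
  filter_upwards [self_mem_nhdsWithin] with ε hε
  have e1 := hswap ν q hν ε hε
  have e2 := hswap ν' q' hν' ε hε
  simp only [div_mul_div_comm, e1, e2]
  rw [mul_comm ((volume : Measure (ι → ℝ)).real (A b ε) * _)]

/-! ### Conditional laws given the previous value -/

/-- Conditionally independent real random variables have a product conditional joint law. -/
theorem ProbabilityTheory.iCondIndepFun.ae_map_condExpKernel_eq_pi {Ω ι : Type*} [Fintype ι]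
    {m mΩ : MeasurableSpace Ω} [StandardBorelSpace Ω] {hm : m ≤ mΩ} {P : Measure Ω}
    [IsProbabilityMeasure P] {W : Ω → ι → ℝ} (hW : Measurable W)
    (h : iCondIndepFun m hm (fun i ω => W ω i) P) :
    ∀ᵐ ω ∂P, (condExpKernel P m ω).map W =
      Measure.pi fun i => (condExpKernel P m ω).map fun ω => W ω i := by
  have hWi : ∀ i, Measurable fun ω => W ω i := fun i => (measurable_pi_apply i).comp hW
  -- Rational boxes are countably many, so one null set serves for all of them, and they determine
  -- the measure.
  have key : ∀ a b : ι → ℚ, ∀ᵐ ω ∂P,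
      condExpKernel P m ω (⋂ i, (fun ω => W ω i) ⁻¹' Set.Ioo (a i : ℝ) (b i)) =
        ∏ i, condExpKernel P m ω ((fun ω => W ω i) ⁻¹' Set.Ioo (a i : ℝ) (b i)) := fun a b =>
    ae_of_ae_trim hm (Kernel.iIndepFun.meas_iInter h fun i => ⟨_, measurableSet_Ioo, rfl⟩)
  have key' := ae_all_iff.2 fun a => ae_all_iff.2 (key a)
  filter_upwards [key'] with ω hω
  have hprob : ∀ i, IsProbabilityMeasure ((condExpKernel P m ω).map fun ω => W ω i) :=
    fun i => Measure.isProbabilityMeasure_map (hWi i).aemeasurable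
  refine (Measure.pi_eq_generateFrom (fun _ => Real.borel_eq_generateFrom_Ioo_rat.symm)
    (fun _ => Real.isPiSystem_Ioo_rat) (fun _ => Real.finiteSpanningSetsInIooRat _)
    fun s hs => ?_).symm
  simp only [Set.mem_iUnion, Set.mem_singleton_iff] at hs
  choose a b _ hab using hs
  obtain rfl : s = fun i => Set.Ioo (a i : ℝ) (b i) := funext hab
  rw [Measure.map_apply hW (MeasurableSet.univ_pi fun i => measurableSet_Ioo)]
  simp_rw [Measure.map_apply (hWi _) measurableSet_Ioo]
  rw [← hω a b]
  congr 1
  ext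
  simp

/-- The conditional distribution of a real random variable given `Y` is its law under the
conditional expectation kernel of the sigma-algebra generated by `Y`. -/
theorem ae_condDistrib_eq_map_condExpKernel {Ω β : Type*} [MeasurableSpace Ω]
    [StandardBorelSpace Ω] [mβ : MeasurableSpace β] {P : Measure Ω} [IsProbabilityMeasure P]
    {X : Ω → ℝ} {Y : Ω → β} (hX : Measurable X) (hY : Measurable Y) :
    ∀ᵐ ω ∂P, condDistrib X Y P (Y ω) = (condExpKernel P (mβ.comap Y) ω).map X := by
  have key := ae_all_iff.2 fun a : ℚ => ae_all_iff.2 fun b : ℚ =>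
    condDistrib_apply_ae_eq_condExpKernel_map (μ := P) hX hY
      (measurableSet_Ioo (a := (a : ℝ)) (b := (b : ℝ)))
  filter_upwards [key] with ω hω
  refine Real.measure_ext_Ioo_rat fun a b => ?_
  rw [hω a b, Kernel.map_apply _ hX]

/-- If the components of `W` and those of `h ∘ W` are independent conditional on `Y`, then for
almost every value of `Y` the map `h` sends the product of the conditional laws of the components
of `W` to a product measure. -/
theorem ae_exists_map_pi_eq_pi {Ω : Type*} [MeasurableSpace Ω] [StandardBorelSpace Ω] {n : ℕ}
    {P : Measure Ω} [IsProbabilityMeasure P] {W Y : Ω → Fin n → ℝ} (hW : Measurable W)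
    (hY : Measurable Y) {h : (Fin n → ℝ) → Fin n → ℝ} (hh : Measurable h)
    (hind : CondIndepComponents P W Y hY)
    (hind' : iCondIndepFun (MeasurableSpace.comap Y inferInstance) hY.comap_le
      (fun i ω => h (W ω) i) P)
    {p : Fin n → ℝ → (Fin n → ℝ) → ℝ} (hp0 : ∀ k a y, 0 < p k a y)
    (hpc : ∀ k y, Continuous fun a => p k a y)
    (hp : ∀ k, IsCondDensity P (fun ω => W ω k) Y (p k)) :
    ∀ᵐ ω ∂P, (∀ k, Integrable fun a => p k a (Y ω)) ∧
      ∃ ν : Fin n → Measure ℝ, (∀ i, IsProbabilityMeasure (ν i)) ∧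
      (Measure.pi fun k => (volume : Measure ℝ).withDensity fun a =>
        ENNReal.ofReal (p k a (Y ω))).map h = Measure.pi ν := by
  have hWi : ∀ i, Measurable fun ω => W ω i := fun i => (measurable_pi_apply i).comp hW
  have hhW : Measurable fun ω => h (W ω) := hh.comp hW
  have h1 := hind.ae_map_condExpKernel_eq_pi hW
  have h2 := hind'.ae_map_condExpKernel_eq_pi hhW
  have h3 := ae_all_iff.2 fun k => ae_condDistrib_eq_map_condExpKernel (P := P) (hWi k) hY
  have h4 := ae_all_iff.2 fun k => ae_of_ae_map hY.aemeasurable (hp k)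
  filter_upwards [h1, h2, h3, h4] with ω h1 h2 h3 h4
  have hlaw : ∀ k, ((volume : Measure ℝ).withDensity fun a => ENNReal.ofReal (p k a (Y ω))) =
      (condExpKernel P (MeasurableSpace.comap Y inferInstance) ω).map fun ω => W ω k :=
    fun k => (h4 k).symm.trans (h3 k)
  refine ⟨fun k => ?_, fun i => (condExpKernel P (MeasurableSpace.comap Y inferInstance) ω).map
    fun ω => h (W ω) i, fun i => Measure.isProbabilityMeasure_map
      ((measurable_pi_apply i).comp hhW).aemeasurable, ?_⟩
  · refine ⟨(hpc k _).aestronglyMeasurable, ?_⟩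
    rw [hasFiniteIntegral_iff_ofReal (ae_of_all _ fun a => (hp0 k a _).le),
      ← setLIntegral_univ, ← withDensity_apply _ MeasurableSet.univ, hlaw k]
    exact measure_lt_top _ _
  · simp_rw [hlaw]
    rw [← h1, ← h2, Measure.map_map hh hW]
    rfl

/-! ### Mixed differences of log-densities and their infinitesimal form -/

/-- Two values of a parametrized family of functions that agree for dense sets of parameters agree
for all parameters. -/
theorem eq_of_eq_on_dense {ι β : Type*} [TopologicalSpace β] {Ψ : ι → β → ℝ}
    (hΨ : ∀ r, Continuous (Ψ r)) {D : ι → Set β} (hD : ∀ r, Dense (D r))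
    (h : ∀ r r', ∀ y ∈ D r, ∀ y' ∈ D r', Ψ r y = Ψ r' y') (r r' : ι) (y y' : β) :
    Ψ r y = Ψ r' y' := by
  have h1 : ∀ y' ∈ D r', Ψ r y = Ψ r' y' := fun y' hy' =>
    congrFun ((hΨ r).ext_on (hD r) (continuous_const (y := Ψ r' y'))
      fun y hy => h r r' y hy y' hy') y
  exact congrFun ((continuous_const (y := Ψ r y)).ext_on (hD r') (hΨ r') h1) y'

/-- The logarithmic form of `density_cross_ratio` for product densities. -/
theorem log_density_rectangle {ι : Type*} [Fintype ι] {h : (ι → ℝ) → ι → ℝ}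
    (hh : IsOpenEmbedding h) {f f' : ι → ℝ → ℝ}
    (hf : ∀ k, Continuous (f k)) (hf' : ∀ k, Continuous (f' k))
    (hfi : ∀ k, Integrable (f k)) (hfi' : ∀ k, Integrable (f' k))
    (hf0 : ∀ k a, 0 < f k a) (hf0' : ∀ k a, 0 < f' k a) {ν ν' : ι → Measure ℝ}
    [∀ i, IsProbabilityMeasure (ν i)] [∀ i, IsProbabilityMeasure (ν' i)]
    (hν : (Measure.pi fun k => (volume : Measure ℝ).withDensity fun a =>
      ENNReal.ofReal (f k a)).map h = Measure.pi ν)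
    (hν' : (Measure.pi fun k => (volume : Measure ℝ).withDensity fun a =>
      ENNReal.ofReal (f' k a)).map h = Measure.pi ν')
    {a b c d : ι → ℝ}
    (hrect : ∀ i, (h a i = h b i ∧ h d i = h c i) ∨ (h a i = h c i ∧ h d i = h b i)) :
    ∑ k, (Real.log (f k (a k)) + Real.log (f k (d k)) - Real.log (f k (b k)) -
        Real.log (f k (c k))) =
      ∑ k, (Real.log (f' k (a k)) + Real.log (f' k (d k)) - Real.log (f' k (b k)) -
        Real.log (f' k (c k))) := by
  rw [pi_withDensity_ofReal f hfi fun k a => (hf0 k a).le] at hν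
  rw [pi_withDensity_ofReal f' hfi' fun k a => (hf0' k a).le] at hν'
  have hpos : ∀ x : ι → ℝ, 0 < ∏ k, f k (x k) := fun x => Finset.prod_pos fun k _ => hf0 k _
  have hpos' : ∀ x : ι → ℝ, 0 < ∏ k, f' k (x k) := fun x => Finset.prod_pos fun k _ => hf0' k _
  have key := density_cross_ratio hh
    (q := fun x => ∏ k, f k (x k)) (q' := fun x => ∏ k, f' k (x k))
    (continuous_finsetProd _ fun k _ => (hf k).comp (continuous_apply k))
    (continuous_finsetProd _ fun k _ => (hf' k).comp (continuous_apply k))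
    hpos hpos' hν hν' hrect
  have hlog : ∀ x : ι → ℝ, Real.log (∏ k, f k (x k)) = ∑ k, Real.log (f k (x k)) :=
    fun x => Real.log_prod fun k _ => (hf0 k _).ne'
  have hlog' : ∀ x : ι → ℝ, Real.log (∏ k, f' k (x k)) = ∑ k, Real.log (f' k (x k)) :=
    fun x => Real.log_prod fun k _ => (hf0' k _).ne'
  have key2 := congrArg Real.log key
  rw [Real.log_mul (mul_pos (hpos a) (hpos d)).ne' (mul_pos (hpos' b) (hpos' c)).ne',
    Real.log_mul (mul_pos (hpos b) (hpos c)).ne' (mul_pos (hpos' a) (hpos' d)).ne',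
    Real.log_mul (hpos a).ne' (hpos d).ne', Real.log_mul (hpos' b).ne' (hpos' c).ne',
    Real.log_mul (hpos b).ne' (hpos c).ne', Real.log_mul (hpos' a).ne' (hpos' d).ne'] at key2
  simp only [hlog, hlog'] at key2
  simp only [Finset.sum_sub_distrib, Finset.sum_add_distrib]
  linarith

/-- If `∑ k, g k (x k)` has vanishing mixed differences along the `h`-preimages of coordinate
rectangles, then its mixed second derivatives in the coordinates given by `h` vanish. -/
theorem mixed_deriv_eq_zero {ι : Type*} [Fintype ι] [DecidableEq ι] {h f : (ι → ℝ) → ι → ℝ}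
    {w : ι → ℝ} (hf : ContDiffAt ℝ 2 f w) (hfh : ∀ᶠ w' in 𝓝 w, h (f w') = w')
    {g g' g'' : ι → ℝ → ℝ} (hg : ∀ k x, HasDerivAt (g k) (g' k x) x)
    (hg' : ∀ k x, HasDerivAt (g' k) (g'' k x) x)
    (hrect : ∀ a b c d : ι → ℝ,
      (∀ i, (h a i = h b i ∧ h d i = h c i) ∨ (h a i = h c i ∧ h d i = h b i)) →
      ∑ k, (g k (a k) + g k (d k) - g k (b k) - g k (c k)) = 0)
    {i j : ι} (hij : i ≠ j) :
    ∑ k, (g'' k (f w k) * (fderiv ℝ f w (Pi.single i 1) k * fderiv ℝ f w (Pi.single j 1) k) +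
      g' k (f w k) * fderiv ℝ (fun w' => fderiv ℝ f w' (Pi.single i 1)) w (Pi.single j 1) k) =
      0 := by
  set u : ι → ℝ := Pi.single i 1 with hu
  set v : ι → ℝ := Pi.single j 1 with hv
  have hline : ∀ w₀ e : ι → ℝ, HasDerivAt (fun s : ℝ => w₀ + s • e) e 0 := fun w₀ e => by
    simpa using ((hasDerivAt_id (0 : ℝ)).smul_const e).const_add w₀
  have hcont : ∀ w₀ e : ι → ℝ, Tendsto (fun s : ℝ => w₀ + s • e) (𝓝 0) (𝓝 w₀) := fun w₀ e => by
    simpa using (hline w₀ e).continuousAt.tendsto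
  have hev : ∀ᶠ w' in 𝓝 w, h (f w') = w' ∧ ContDiffAt ℝ 2 f w' :=
    hfh.and (hf.eventually (by simp))
  -- The derivative in direction `u` at the point `w + t • v`. Vanishing mixed differences make the
  -- slices through `w + t • v` and `w` differ by a constant, so `M` is locally constant.
  set M : ℝ → ℝ := fun t => ∑ k, g' k (f (w + t • v) k) * fderiv ℝ f (w + t • v) u k with hM
  have hslice : ∀ w₀, ContDiffAt ℝ 2 f w₀ → HasDerivAt (fun s : ℝ => ∑ k, g k (f (w₀ + s • u) k))
      (∑ k, g' k (f w₀ k) * fderiv ℝ f w₀ u k) 0 := by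
    intro w₀ h₀
    refine HasDerivAt.fun_sum fun k _ => ?_
    have h1 : HasDerivAt (fun s : ℝ => f (w₀ + s • u)) (fderiv ℝ f w₀ u) 0 :=
      HasFDerivAt.comp_hasDerivAt_of_eq 0 (h₀.differentiableAt (by simp)).hasFDerivAt (hline w₀ u)
        (by simp)
    exact HasDerivAt.comp_of_eq 0 (hg k _) (hasDerivAt_pi.1 h1 k) (by simp)
  have hMconst : ∀ᶠ t in 𝓝 (0 : ℝ), M t = M 0 := by
    filter_upwards [(hcont w v).eventually hev.eventually_nhds] with t ht
    have h0 := hev.self_of_nhds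
    have ht0 := ht.self_of_nhds
    have e1 := hslice _ ht0.2
    have e2 := hslice _ h0.2
    have hM0 : M 0 = ∑ k, g' k (f w k) * fderiv ℝ f w u k := by simp [hM]
    rw [hM0]
    refine (e1.congr_of_eventuallyEq ?_).unique (e2.add_const
      (∑ k, g k (f (w + t • v) k) - ∑ k, g k (f w k)))
    filter_upwards [(hcont (w + t • v) u).eventually ht, (hcont w u).eventually hev] with s hs hs'
    have := hrect (f (w + t • v + s • u)) (f (w + s • u)) (f (w + t • v)) (f w) (by
      intro l
      rw [hs.1, hs'.1, ht0.1, h0.1]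
      by_cases hl : l = j
      · right
        have : u l = 0 := by rw [hu, hl]; exact Pi.single_eq_of_ne hij.symm _
        simp [this]
      · left
        have : v l = 0 := Pi.single_eq_of_ne hl _
        simp [this])
    simp only [Finset.sum_sub_distrib, Finset.sum_add_distrib] at this
    linarith
  have hMderiv : HasDerivAt M (∑ k, (g'' k (f w k) * (fderiv ℝ f w u k * fderiv ℝ f w v k) +
      g' k (f w k) * fderiv ℝ (fun w' => fderiv ℝ f w' u) w v k)) 0 := by
    refine HasDerivAt.fun_sum fun k _ => ?_
    have h1 : HasDerivAt (fun t : ℝ => f (w + t • v)) (fderiv ℝ f w v) 0 :=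
      HasFDerivAt.comp_hasDerivAt_of_eq 0 (hf.differentiableAt (by simp)).hasFDerivAt (hline w v)
        (by simp)
    have h2 : HasDerivAt (fun t : ℝ => g' k (f (w + t • v) k)) (g'' k (f w k) * fderiv ℝ f w v k)
        0 := HasDerivAt.comp_of_eq 0 (hg' k _) (hasDerivAt_pi.1 h1 k) (by simp)
    have h3 : DifferentiableAt ℝ (fun w' => fderiv ℝ f w' u) w :=
      ((hf.fderiv_right (m := 1) (by norm_num)).differentiableAt (by simp)).clm_apply
        (differentiableAt_const u)
    have h4 : HasDerivAt (fun t : ℝ => fderiv ℝ f (w + t • v) u)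
        (fderiv ℝ (fun w' => fderiv ℝ f w' u) w v) 0 :=
      HasFDerivAt.comp_hasDerivAt_of_eq 0 h3.hasFDerivAt (hline w v) (by simp)
    refine (h2.mul (hasDerivAt_pi.1 h4 k)).congr_deriv ?_
    simp only [zero_smul, add_zero]
    ring
  exact hMderiv.unique ((hasDerivAt_const (0 : ℝ) (M 0)).congr_of_eventuallyEq hMconst)

/-! ### Jacobians with one non-zero entry in each row -/

/-- A matrix whose left inverse has at most one non-zero entry in each row has exactly one non-zero
entry in each row. -/
theorem Matrix.existsUnique_ne_zero_of_mul_eq_one {ι : Type*} [Fintype ι] [DecidableEq ι]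
    {A B : Matrix ι ι ℝ} (hAB : A * B = 1) (hA : ∀ k i j, i ≠ j → A k i * A k j = 0) (i : ι) :
    ∃ l, B i l ≠ 0 ∧ ∀ l', l' ≠ l → B i l' = 0 := by
  have hex : ∀ k, ∃ i, A k i ≠ 0 := by
    intro k
    by_contra! hk
    have := congrFun (congrFun hAB k) k
    simp [Matrix.mul_apply, hk] at this
  -- The column of the only non-zero entry in row `k` of `A`; the product `A * B` then reduces to
  -- one term, which determines row `τ k` of `B`.
  choose τ hτ using hex
  have hz : ∀ k j, j ≠ τ k → A k j = 0 := fun k j hj =>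
    (mul_eq_zero.1 (hA k j (τ k) hj)).resolve_right (hτ k)
  have hmul : ∀ k l, A k (τ k) * B (τ k) l = (1 : Matrix ι ι ℝ) k l := by
    intro k l
    rw [← hAB, Matrix.mul_apply, Finset.sum_eq_single (τ k)]
    · intro j _ hj
      rw [hz k j hj, zero_mul]
    · simp
  have hdiag : ∀ k, B (τ k) k ≠ 0 := fun k h0 => by simpa [h0] using hmul k k
  have hoff : ∀ k l, l ≠ k → B (τ k) l = 0 := fun k l hl => by
    have := hmul k l
    rw [Matrix.one_apply_ne hl.symm] at this
    exact (mul_eq_zero.1 this).resolve_left (hτ k)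
  have hinj : Function.Injective τ := by
    intro k l hkl
    by_contra hne
    exact hdiag l (hkl ▸ hoff k l (Ne.symm hne))
  obtain ⟨k, rfl⟩ := Finite.surjective_of_injective hinj i
  exact ⟨k, hdiag k, hoff k⟩

/-- A `C¹` map whose Jacobian is everywhere invertible with exactly one non-zero entry in each row
is a permuted component-wise transformation. -/
theorem exists_perm_componentwise {ι : Type*} [Fintype ι] [DecidableEq ι] {h : (ι → ℝ) → ι → ℝ}
    (hh : ContDiff ℝ 1 h) (hinj : Function.Injective h)
    (hjac : ∀ z, (fderiv ℝ h z).det ≠ 0)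
    (hrow : ∀ z i, ∃ l, fderiv ℝ h z (Pi.single l 1) i ≠ 0 ∧
      ∀ l', l' ≠ l → fderiv ℝ h z (Pi.single l' 1) i = 0) :
    ∃ (σ : Equiv.Perm ι) (T : ι → ℝ → ℝ), (∀ i, IsOpenEmbedding (T i)) ∧
      ∀ z i, h z i = T i (z (σ i)) := by
  have hd : Differentiable ℝ h := hh.differentiable (by simp)
  have hcont : ∀ i l, Continuous fun z => fderiv ℝ h z (Pi.single l 1) i := fun i l =>
    (continuous_apply i).comp ((hh.continuous_fderiv (by simp)).clm_apply continuous_const)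
  have hconst : ∀ i, ∃ l, ∀ z, fderiv ℝ h z (Pi.single l 1) i ≠ 0 ∧
      ∀ l', l' ≠ l → fderiv ℝ h z (Pi.single l' 1) i = 0 := by
    intro i
    choose l hl hl' using fun z => hrow z i
    -- A non-zero entry stays non-zero nearby, and it is the only one in its row.
    have hloc : IsLocallyConstant l := by
      rw [IsLocallyConstant.iff_eventually_eq]
      intro z
      filter_upwards [(hcont i (l z)).continuousAt.eventually_ne (hl z)] with z' hz'
      by_contra hne
      exact hz' (hl' z' _ (Ne.symm hne))
    refine ⟨l 0, fun z => ?_⟩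
    rw [← hloc.apply_eq_of_isPreconnected isPreconnected_univ (Set.mem_univ z) (Set.mem_univ 0)]
    exact ⟨hl z, hl' z⟩
  choose σ hσ using hconst
  have hexpand : ∀ z v i, fderiv ℝ h z v i = v (σ i) * fderiv ℝ h z (Pi.single (σ i) 1) i := by
    intro z v i
    conv_lhs => rw [pi_eq_sum_univ' v, map_sum, Finset.sum_apply]
    rw [Finset.sum_eq_single (σ i)]
    · rw [map_smul, Pi.smul_apply, smul_eq_mul]
    · intro l _ hl
      rw [map_smul, Pi.smul_apply, smul_eq_mul]
      exact mul_eq_zero_of_right _ ((hσ i z).2 l hl)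
    · simp
  have hsurj : Function.Surjective σ := by
    intro l
    by_contra! hl
    have h0 : fderiv ℝ h 0 (Pi.single l 1) = 0 := by
      ext i
      exact (hσ i 0).2 l (hl i).symm
    have h1 := ((fderiv ℝ h 0).toContinuousLinearEquivOfDetNeZero (hjac 0)).map_eq_zero_iff.1 h0
    simpa using congrFun h1 l
  have hbij : Function.Bijective σ := Finite.surjective_iff_bijective.1 hsurj
  have hline : ∀ (w₀ e : ι → ℝ) (i : ι) (s : ℝ), HasStrictDerivAt (fun s : ℝ => h (w₀ + s • e) i)
      (e (σ i) * fderiv ℝ h (w₀ + s • e) (Pi.single (σ i) 1) i) s := by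
    intro w₀ e i s
    rw [← hexpand]
    have h1 : HasStrictDerivAt (fun s : ℝ => w₀ + s • e) e s := by
      simpa using ((hasStrictDerivAt_id s).smul_const e).const_add w₀
    exact hasStrictDerivAt_pi.1
      ((hh.contDiffAt.hasStrictFDerivAt (by simp)).comp_hasStrictDerivAt s h1) i
  -- Only the coordinate `σ i` matters, so the value may be read off on the diagonal; the segment
  -- from `z` to the diagonal point used below keeps that coordinate fixed.
  set T : ι → ℝ → ℝ := fun i x => h (fun _ => x) i
  have hhT : ∀ z i, h z i = T i (z (σ i)) := by
    intro z i
    have hz : ∀ s : ℝ, HasDerivAt (fun s : ℝ => h (z + s • ((fun _ => z (σ i)) - z)) i) 0 s :=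
      fun s =>
      (hline z ((fun _ => z (σ i)) - z) i s).hasDerivAt.congr_deriv (by
        simp only [Pi.sub_apply, sub_self, zero_mul])
    have := is_const_of_deriv_eq_zero (fun s => (hz s).differentiableAt) (fun s => (hz s).deriv) 0 1
    simpa using this
  have hTd : ∀ i x, HasStrictDerivAt (T i) (fderiv ℝ h (fun _ => x) (Pi.single (σ i) 1) i) x := by
    intro i x
    have := hline 0 (fun _ => 1) i x
    have e : ∀ s : ℝ, (0 : ι → ℝ) + s • (fun _ => (1 : ℝ)) = fun _ => s := fun s => by
      ext; simp
    simpa only [e, one_mul] using this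
  refine ⟨Equiv.ofBijective σ hbij, T, fun i => ?_, hhT⟩
  refine .of_continuous_injective_isOpenMap
    (continuous_iff_continuousAt.2 fun x => (hTd i x).hasDerivAt.continuousAt) ?_
    (isOpenMap_of_hasStrictDerivAt (hTd i) fun x => (hσ i _).1)
  intro x y hxy
  -- Injectivity of `h` passes to `T i`: these points differ at most in the coordinate `σ i`, which
  -- only the component `i` of `h` sees.
  have : h (Pi.single (σ i) x) = h (Pi.single (σ i) y) := by
    ext j
    rw [hhT, hhT]
    by_cases hj : j = i
    · subst hj
      simpa using hxy
    · have : σ j ≠ σ i := fun e => hj (hbij.1 e)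
      simp [Pi.single_eq_of_ne this]
  simpa using congrFun (hinj this) (σ i)

/-! ### From linear independence to the shape of the Jacobian -/

/-- Linear independence of the vector functions built from the log-densities forces the
coefficients of any linear relation, with right-hand side independent of the context and of the
previous value, to vanish. -/
theorem RegularLogDensity.coeff_eq_zero {m n : ℕ} {η : Fin m → Fin n → ℝ → (Fin n → ℝ) → ℝ}
    (hη : RegularLogDensity η) {z : Fin n → ℝ} (hlin : LinearIndependent ℝ (sFamily η z))
    {α β : Fin n → ℝ}
    (h : ∀ r r' y y', ∑ k, ((d2Eta η r k (z k) y - d2Eta η r' k (z k) y') * α k +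
      (dEta η r k (z k) y - dEta η r' k (z k) y') * β k) = 0) :
    α = 0 ∧ β = 0 := by
  have hv : ∀ r l y, ∑ k, (vRingEntry η r k l (z k) y * α k + vEntry η r k l (z k) y * β k) =
      0 := by
    intro r l y
    -- Same context, one previous value frozen: differentiating in the other gives the `v` and `v̊`
    -- entries.
    have hder : HasFDerivAt (fun y' => ∑ k, ((d2Eta η r k (z k) y' - d2Eta η r k (z k) y) * α k +
        (dEta η r k (z k) y' - dEta η r k (z k) y) * β k))
        (∑ k, (α k • fderiv ℝ (fun y' => d2Eta η r k (z k) y') y +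
          β k • fderiv ℝ (fun y' => dEta η r k (z k) y') y)) y :=
      HasFDerivAt.fun_sum fun k _ =>
        (((hη.diff_y_d2z r k (z k) y).hasFDerivAt.sub_const _).mul_const (α k)).add
          (((hη.diff_y_dz r k (z k) y).hasFDerivAt.sub_const _).mul_const (β k))
    have h0 := hder.unique (((hasFDerivAt_const (0 : ℝ) y).congr_of_eventuallyEq
      (Eventually.of_forall fun y' => h r r y' y)))
    have := DFunLike.congr_fun h0 (Pi.single l 1)
    simpa [_root_.sum_apply, vRingEntry, vEntry, mul_comm] using this
  have hcoef := Fintype.linearIndependent_iff.1 hlin (Sum.elim β α) (by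
    funext y e
    rw [Fintype.sum_sum_type]
    rcases e with ⟨r, l⟩ | i
    · have := hv r l y
      rw [Finset.sum_add_distrib] at this
      simpa [sFamily, sVec, sRingVec, Finset.sum_apply, mul_comm, add_comm] using this
    -- Same previous value, consecutive contexts: this gives the remaining entries.
    · have := h (ctxNext i) (ctxCur i) y y
      rw [Finset.sum_add_distrib] at this
      simpa [sFamily, sVec, sRingVec, Finset.sum_apply, mul_comm, add_comm] using this)
  exact ⟨funext fun k => hcoef (Sum.inr k), funext fun k => hcoef (Sum.inl k)⟩

/-- If `h` is a `C²` injective map with invertible Jacobian, along whose coordinate rectangles the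
mixed differences of the log-densities do not depend on the context and the previous value, then
its Jacobian has exactly one non-zero entry in each row. -/
theorem RegularLogDensity.existsUnique_fderiv_ne_zero {m n : ℕ}
    {η : Fin m → Fin n → ℝ → (Fin n → ℝ) → ℝ} (hη : RegularLogDensity η)
    (hlin : ∀ z, LinearIndependent ℝ (sFamily η z)) {h : (Fin n → ℝ) → Fin n → ℝ}
    (hh : ContDiff ℝ 2 h) (hjac : ∀ z, (fderiv ℝ h z).det ≠ 0)
    (hrect : ∀ a b c d : Fin n → ℝ,
      (∀ i, (h a i = h b i ∧ h d i = h c i) ∨ (h a i = h c i ∧ h d i = h b i)) →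
      ∀ r r' y y', ∑ k, (η r k (a k) y + η r k (d k) y - η r k (b k) y - η r k (c k) y) =
        ∑ k, (η r' k (a k) y' + η r' k (d k) y' - η r' k (b k) y' - η r' k (c k) y'))
    (z : Fin n → ℝ) (i : Fin n) :
    ∃ l, fderiv ℝ h z (Pi.single l 1) i ≠ 0 ∧
      ∀ l', l' ≠ l → fderiv ℝ h z (Pi.single l' 1) i = 0 := by
  set e := (fderiv ℝ h z).toContinuousLinearEquivOfDetNeZero (hjac z)
  have he : HasFDerivAt h (e : (Fin n → ℝ) →L[ℝ] Fin n → ℝ) z := by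
    rw [ContinuousLinearMap.coe_toContinuousLinearEquivOfDetNeZero]
    exact (hh.differentiable (by simp) z).hasFDerivAt
  have hes : HasStrictFDerivAt h (e : (Fin n → ℝ) →L[ℝ] Fin n → ℝ) z :=
    hh.contDiffAt.hasStrictFDerivAt' he (by simp)
  set f := hes.localInverse h e z
  have hfz : f (h z) = z := hes.localInverse_apply_image
  have hf2 : ContDiffAt ℝ 2 f (h z) := hh.contDiffAt.to_localInverse he (by simp)
  have hfd : fderiv ℝ f (h z) = (e.symm : (Fin n → ℝ) →L[ℝ] Fin n → ℝ) :=
    hes.to_localInverse.hasFDerivAt.fderiv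
  have hzero : ∀ k i j, i ≠ j →
      e.symm (Pi.single i 1) k * e.symm (Pi.single j 1) k = 0 := by
    intro k i j hij
    have hrel := fun r r' y y' => mixed_deriv_eq_zero hf2 hes.eventually_right_inverse
      (g := fun k x => η r k x y - η r' k x y')
      (g' := fun k x => dEta η r k x y - dEta η r' k x y')
      (g'' := fun k x => d2Eta η r k x y - d2Eta η r' k x y')
      (fun k x => (hη.diff_z r k y x).hasDerivAt.sub (hη.diff_z r' k y' x).hasDerivAt)
      (fun k x => (hη.diff_dz r k y x).hasDerivAt.sub (hη.diff_dz r' k y' x).hasDerivAt)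
      (fun a b c d habcd => by
        rw [← sub_eq_zero.2 (hrect a b c d habcd r r' y y'), ← Finset.sum_sub_distrib]
        exact Finset.sum_congr rfl fun k _ => by ring) hij
    simp only [hfz] at hrel
    have := (hη.coeff_eq_zero (hlin z) hrel).1
    -- Only the coefficients of the second derivatives are needed; the others, mixed second
    -- derivatives of `f`, vanish as well.
    simpa [hfd] using congrFun this k
  have hmul : LinearMap.toMatrix' (e.symm : (Fin n → ℝ) →ₗ[ℝ] Fin n → ℝ) *
      LinearMap.toMatrix' (e : (Fin n → ℝ) →ₗ[ℝ] Fin n → ℝ) = 1 := by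
    rw [← LinearMap.toMatrix'_comp]
    convert LinearMap.toMatrix'_id
    ext
    simp
  have hrows := Matrix.existsUnique_ne_zero_of_mul_eq_one hmul (fun k i j hij => by
    simpa [LinearMap.toMatrix'_apply] using hzero k i j hij) i
  simpa [LinearMap.toMatrix'_apply, e] using hrows

/-! ### Proof of the theorem -/

/-- Conditional independence only depends on the conditioning sigma-algebra. -/
theorem ProbabilityTheory.iCondIndepFun.congr_sigmaAlgebra {Ω ι : Type*}
    {m m' mΩ : MeasurableSpace Ω} [StandardBorelSpace Ω] {P : Measure Ω} [IsFiniteMeasure P]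
    {W : ι → Ω → ℝ} (hmm : m = m')
    {hm : m ≤ mΩ} (hm' : m' ≤ mΩ) (h : iCondIndepFun m hm W P) : iCondIndepFun m' hm' W P := by
  subst hmm
  exact h

theorem theorem2 {n m : ℕ}
    {Ω : Type*} [MeasurableSpace Ω] [StandardBorelSpace Ω]
    {X : Type*}
    -- the law `P r` of the whole system in the context `u_r`
    (P : Fin m → Measure Ω) [∀ r, IsProbabilityMeasure (P r)]
    -- the latent process, the observed process and the estimated latent process
    (Z : ℕ → Ω → Fin n → ℝ) (x : ℕ → Ω → X) (Zhat : ℕ → Ω → Fin n → ℝ)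
    (hZ : ∀ s, Measurable (Z s)) (hZhat : ∀ s, Measurable (Zhat s))
    -- the invertible mixing function and the invertible estimated map
    (g : (Fin n → ℝ) → X) (ghat : X → Fin n → ℝ)
    (hg : Function.Injective g) (hghat : Set.InjOn ghat (Set.range g))
    (hx : ∀ s ω, x s ω = g (Z s ω)) (hzhat : ∀ s ω, Zhat s ω = ghat (x s ω))
    -- the map from true to estimated latents is smooth with invertible Jacobian
    (hsmooth : ContDiff ℝ 2 fun z => ghat (g z))
    (hjac : ∀ z, (fderiv ℝ (fun z => ghat (g z)) z).det ≠ 0)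
    (t : ℕ) (ht : 1 ≤ t)
    -- in each context the previous latent vector has full support
    (hsupp : ∀ r (U : Set (Fin n → ℝ)), IsOpen U → U.Nonempty → P r (Z (t - 1) ⁻¹' U) ≠ 0)
    -- the positive conditional densities `p(z_{kt} | z_{t-1}; u_r)`
    (p : Fin m → Fin n → ℝ → (Fin n → ℝ) → ℝ)
    (hp_pos : ∀ r k a y, 0 < p r k a y)
    (hp : ∀ r k, IsCondDensity (P r) (fun ω => Z t ω k) (Z (t - 1)) (p r k))
    (hreg : RegularLogDensity (logDensity p))
    -- conditional independence of the true and of the estimated components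
    (hindep : ∀ r, CondIndepComponents (P r) (Z t) (Z (t - 1)) (hZ (t - 1)))
    (hindep_hat : ∀ r, CondIndepComponents (P r) (Zhat t) (Zhat (t - 1)) (hZhat (t - 1)))
    -- for each value of `z_t`, the `2n` vector functions of `z_{t-1}` are linearly independent
    (hlin : ∀ z : Fin n → ℝ, LinearIndependent ℝ (sFamily (logDensity p) z)) :
    ∃ (σ : Equiv.Perm (Fin n)) (T : Fin n → ℝ → ℝ),
      (∀ i, Topology.IsOpenEmbedding (T i)) ∧
      (∀ z i, ghat (g z) i = T i (z (σ i))) ∧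
      ∀ s ω i, Zhat s ω i = T i (Z s ω (σ i)) := by
  set h : (Fin n → ℝ) → Fin n → ℝ := fun z => ghat (g z)
  have hZh : ∀ s ω, Zhat s ω = h (Z s ω) := fun s ω => by rw [hzhat, hx]
  have hinj : Function.Injective h := fun z z' hzz' => hg (hghat ⟨z, rfl⟩ ⟨z', rfl⟩ hzz')
  have hopen : IsOpenMap h := isOpenMap_of_hasStrictFDerivAt_equiv
    (f' := fun z => (fderiv ℝ h z).toContinuousLinearEquivOfDetNeZero (hjac z)) fun z => by
      rw [ContinuousLinearMap.coe_toContinuousLinearEquivOfDetNeZero]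
      exact hsmooth.contDiffAt.hasStrictFDerivAt (by simp)
  have hemb : IsOpenEmbedding h :=
    .of_continuous_injective_isOpenMap hsmooth.continuous hinj hopen
  -- An open embedding loses no measurable information, so conditioning on the estimated or on the
  -- true previous value is the same.
  have hcomap : MeasurableSpace.comap (Zhat (t - 1)) inferInstance =
      MeasurableSpace.comap (Z (t - 1)) inferInstance := by
    rw [show Zhat (t - 1) = h ∘ Z (t - 1) from funext (hZh (t - 1)), ← MeasurableSpace.comap_comp,
      hemb.measurableEmbedding.comap_eq]
  have hindep' : ∀ r, iCondIndepFun (MeasurableSpace.comap (Z (t - 1)) inferInstance)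
      (hZ (t - 1)).comap_le (fun i ω => h (Z t ω) i) (P r) := by
    intro r
    simp_rw [← hZh]
    exact iCondIndepFun.congr_sigmaAlgebra hcomap _ (hindep_hat r)
  have hexp : ∀ r k a y, p r k a y = Real.exp (logDensity p r k a y) := fun r k a y =>
    (Real.exp_log (hp_pos r k a y)).symm
  have hpc : ∀ r k y, Continuous fun a => p r k a y := fun r k y => by
    simp_rw [hexp]
    exact Real.continuous_exp.comp (hreg.diff_z r k y).continuous
  -- The previous values at which the almost-sure statements hold; being of full measure under a law
  -- of full support, this set is dense.
  set D : Fin m → Set (Fin n → ℝ) := fun r => {y | (∀ k, Integrable fun a => p r k a y) ∧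
    ∃ ν : Fin n → Measure ℝ, (∀ i, IsProbabilityMeasure (ν i)) ∧
      (Measure.pi fun k => (volume : Measure ℝ).withDensity fun a =>
        ENNReal.ofReal (p r k a y)).map h = Measure.pi ν}
  have hD : ∀ r, Dense (D r) := by
    intro r
    rw [dense_iff_inter_open]
    intro U hU hUne
    by_contra hempty
    refine hsupp r U hU hUne ?_
    refine measure_mono_null (fun ω hω hωD => hempty ⟨Z (t - 1) ω, hω, hωD⟩)
      (ae_iff.1 (ae_exists_map_pi_eq_pi (hZ t) (hZ (t - 1)) hemb.continuous.measurable (hindep r)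
        (hindep' r) (hp_pos r) (hpc r) (hp r)))
  have hrect : ∀ a b c d : Fin n → ℝ,
      (∀ i, (h a i = h b i ∧ h d i = h c i) ∨ (h a i = h c i ∧ h d i = h b i)) →
      ∀ r r' y y', ∑ k, (logDensity p r k (a k) y + logDensity p r k (d k) y -
        logDensity p r k (b k) y - logDensity p r k (c k) y) =
        ∑ k, (logDensity p r' k (a k) y' + logDensity p r' k (d k) y' -
          logDensity p r' k (b k) y' - logDensity p r' k (c k) y') := by
    intro a b c d habcd
    refine eq_of_eq_on_dense (Ψ := fun r y => ∑ k, (logDensity p r k (a k) y +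
      logDensity p r k (d k) y - logDensity p r k (b k) y - logDensity p r k (c k) y))
      (fun r => continuous_finsetSum _ fun k _ => ?_) hD ?_
    · have := fun x => (hreg.diff_y r k x).continuous
      exact (((this _).add (this _)).sub (this _)).sub (this _)
    · rintro r r' y ⟨hi, ν, hν, hmap⟩ y' ⟨hi', ν', hν', hmap'⟩
      exact log_density_rectangle hemb (fun k => hpc r k y) (fun k => hpc r' k y') hi hi'
        (fun k x => hp_pos r k x y) (fun k x => hp_pos r' k x y') hmap hmap' habcd
  obtain ⟨σ, T, hT, hhT⟩ := exists_perm_componentwise (hsmooth.of_le (by norm_num)) hinj hjac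
    (hreg.existsUnique_fderiv_ne_zero hlin hsmooth hjac hrect)
  exact ⟨σ, T, hT, hhT, fun s ω i => by rw [hZh, hhT]⟩
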